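/- Let $n,m,k_n,k_m,s_n,s_m$ be nonnegative integers with $s_n\le k_n$, $s_m\le k_m$, and with $k_n=n$ if $s_n=0$, $k_m=m$ if $s_m=0$. Let $p\in(0,1]$, $\sigma>0$, and let $\mathcal D_n,\mathcal D_m\subseteq\mathbb R$ (alphabets) both contain $\{0,1\}$. For $s_n\ge 1$ let $\mathcal A_{s_n}$ be the set of matrices in $\mathcal D_n^{n\times k_n}$ each of whose rows has at most $s_n$ nonzero entries; for $s_n=0$ let $\mathcal A_{s_n}=\{\mathbf I_{n\times n}\}$. Define $\mathcal A_{s_m}\subseteq\mathbb R^{m\times k_m}$ in the same way from $m,k_m,s_m,\mathcal D_m$, and put $$\Theta(s_n,s_m)=\{XBZ^T:\ X\in\mathcal A_{s_n},\ B\in\mathbb R^{k_n\times k_m},\ Z\in\mathcal A_{s_m}\}.$$ Let $\Theta_*(s_n,s_m)$ be defined in the same way with "at most" replaced by "exactly". For $\theta\in\mathbb R^{n\times m}$ let $\mathbb P_\theta$, with expectation $\mathbb E_\theta$, be the law of the random matrix $Y$ with entries $Y_{ij}=E_{ij}(\theta_{ij}+\xi_{ij})$, where the $E_{ij}$ are i.i.d.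 Bernoulli with parameter $p$, the $\xi_{ij}$ are i.i.d. $\mathcal N(0,\sigma^2)$, and $(E_{ij})$ is independent of $(\xi_{ij})$. Put $r_n=\min(n,k_n)$, $r_m=\min(m,k_m)$ and, with the convention $0\log\frac{x}{0}=0$, $$R_X=\min\Big(nr_m,\ ns_n\log\frac{ek_n}{s_n}\Big),\qquad R_B=r_nr_m,\qquad R_Z=\min\Big(mr_n,\ ms_m\log\frac{ek_m}{s_m}\Big).$$ There is an absolute constant $C>0$ such that, for all the above parameters, $$\inf_{\hat\vartheta}\sup_{\theta\in\Theta(s_n,s_m)}\mathbb P_\theta\Big\{\|\hat\vartheta-\theta\|_2^2\ge\frac{C\sigma^2}{p}(R_X+R_B+R_Z)\Big\}\ge 0.1$$ and $$\inf_{\hat\vartheta}\sup_{\theta\in\Theta(s_n,s_m)}\mathbb E_\theta\|\hat\vartheta-\theta\|_2^2\ge\frac{C\sigma^2}{p}(R_X+R_B+R_Z),$$ where $\|\cdot\|_2$ is the Frobenius norm and the infima are over all estimators $\hat\vartheta$, i.e. all measurable functions of $Y$ with values in $\mathbb R^{n\times m}$. Furthermore, the same two inequalities hold with $\Theta_*(s_n,s_m)$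 in place of $\Theta(s_n,s_m)$ if $s_n,s_m\in\{0,1\}$, except in the degenerate cases $s_n=k_n=1,\ \mathcal D_n=\{0,1\}$ and $s_m=k_m=1,\ \mathcal D_m=\{0,1\}$ (in which the corresponding factor set consists of the all-ones column only). -/

import Mathlib

open MeasureTheory ProbabilityTheory
open scoped ENNReal

/-- Real matrices carry the product (Borel) sigma-algebra of their entries. -/
instance matrixMeasurableSpace (n m : ℕ) : MeasurableSpace (Matrix (Fin n) (Fin m) ℝ) :=
  inferInstanceAs (MeasurableSpace (Fin n → Fin m → ℝ))

noncomputable section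

/-- The set `𝒜_s(n, k)` of factor matrices over the alphabet `D`: for `s ≥ 1` the matrices with
entries in `D` all of whose rows have at most `s` nonzero entries; for `s = 0` (where `k = n` is
assumed) the singleton consisting of the identity matrix. -/
def factorSet (D : Set ℝ) (n k s : ℕ) : Set (Matrix (Fin n) (Fin k) ℝ) :=
  if s = 0 then {A | ∀ i j, A i j = if (i : ℕ) = (j : ℕ) then 1 else 0}
  else {A | (∀ i j, A i j ∈ D) ∧ ∀ i, hammingNorm (A i) ≤ s}

/-- The same set with exactly `s` nonzero entries in each row when `s ≥ 1`. -/
def factorSetEq (D : Set ℝ) (n k s : ℕ) : Set (Matrix (Fin n) (Fin k) ℝ) :=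
  if s = 0 then {A | ∀ i j, A i j = if (i : ℕ) = (j : ℕ) then 1 else 0}
  else {A | (∀ i j, A i j ∈ D) ∧ ∀ i, hammingNorm (A i) = s}

/-- The class `Θ(s_n, s_m)` of matrices `X B Zᵀ`, with `X`, `Z` in the factor sets
and `B` arbitrary. -/
def thetaClass (Dn Dm : Set ℝ) (n m kn km sn sm : ℕ) : Set (Matrix (Fin n) (Fin m) ℝ) :=
  {θ | ∃ X ∈ factorSet Dn n kn sn, ∃ B : Matrix (Fin kn) (Fin km) ℝ,
    ∃ Z ∈ factorSet Dm m km sm, θ = X * B * Z.transpose}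

/-- The class `Θ_*(s_n, s_m)`: as above, with exact row sparsity. -/
def thetaClassEq (Dn Dm : Set ℝ) (n m kn km sn sm : ℕ) : Set (Matrix (Fin n) (Fin m) ℝ) :=
  {θ | ∃ X ∈ factorSetEq Dn n kn sn, ∃ B : Matrix (Fin kn) (Fin km) ℝ,
    ∃ Z ∈ factorSetEq Dm m km sm, θ = X * B * Z.transpose}

/-- The law `ℙ_θ` of `Y`, `Y i j = E i j * (θ i j + ξ i j)`, where the `E i j` are i.i.d. Bernoulli
variables with parameter `p`, the `ξ i j` are i.i.d. `N(0, σ²)`, and `E` and `ξ` are independent. -/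
def completionLaw {n m : ℕ} (p : unitInterval) (σ : ℝ) (θ : Matrix (Fin n) (Fin m) ℝ) :
    Measure (Matrix (Fin n) (Fin m) ℝ) :=
  ((Measure.pi fun _ : Fin n × Fin m => bernoulliMeasure (1 : ℝ) 0 p).prod
    (Measure.pi fun _ : Fin n × Fin m => gaussianReal 0 (σ ^ 2).toNNReal)).map
    fun ω => Matrix.of fun i j => ω.1 (i, j) * (θ i j + ω.2 (i, j))

/-- Squared Frobenius norm. -/
def frobSq {n m : ℕ} (A : Matrix (Fin n) (Fin m) ℝ) : ℝ := ∑ i, ∑ j, A i j ^ 2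

/-- `inf_ϑ sup_{θ ∈ Θ} ℙ_θ(‖ϑ - θ‖² ≥ t)`, the infimum over all estimators, that is, over all
measurable functions of the observed matrix. -/
def minimaxDevProb {n m : ℕ} (p : unitInterval) (σ : ℝ) (Θ : Set (Matrix (Fin n) (Fin m) ℝ))
    (t : ℝ) : ℝ≥0∞ :=
  ⨅ (ϑ : Matrix (Fin n) (Fin m) ℝ → Matrix (Fin n) (Fin m) ℝ) (_ : Measurable ϑ),
    ⨆ θ ∈ Θ, completionLaw p σ θ {y | t ≤ frobSq (ϑ y - θ)}

/-- `inf_ϑ sup_{θ ∈ Θ} 𝔼_θ ‖ϑ - θ‖²`, an extended nonnegative number, the infimum over all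
estimators. -/
def minimaxSqRisk {n m : ℕ} (p : unitInterval) (σ : ℝ) (Θ : Set (Matrix (Fin n) (Fin m) ℝ)) :
    ℝ≥0∞ :=
  ⨅ (ϑ : Matrix (Fin n) (Fin m) ℝ → Matrix (Fin n) (Fin m) ℝ) (_ : Measurable ϑ),
    ⨆ θ ∈ Θ, ∫⁻ y, ENNReal.ofReal (frobSq (ϑ y - θ)) ∂completionLaw p σ θ

/-- `R_X = n r_m ∧ n s_n log(e k_n / s_n)` with `r_m = m ∧ k_m`; it is `0` for `s_n = 0`. -/
def rateX (n m kn km sn : ℕ) : ℝ :=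
  min ((n : ℝ) * (min m km : ℕ)) ((n : ℝ) * (sn * Real.log (Real.exp 1 * kn / sn)))

/-- `R_B = r_n r_m`. -/
def rateB (n m kn km : ℕ) : ℝ := ((min n kn : ℕ) : ℝ) * (min m km : ℕ)

/-- `R_Z = m r_n ∧ m s_m log(e k_m / s_m)` with `r_n = n ∧ k_n`; it is `0` for `s_m = 0`. -/
def rateZ (n m kn km sm : ℕ) : ℝ :=
  min ((m : ℝ) * (min n kn : ℕ)) ((m : ℝ) * (sm * Real.log (Real.exp 1 * km / sm)))

/-- The rate `(σ² / p) (R_X + R_B + R_Z)`. -/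
def completionRate (n m kn km sn sm : ℕ) (p : unitInterval) (σ : ℝ) : ℝ :=
  σ ^ 2 / (p : ℝ) * (rateX n m kn km sn + rateB n m kn km + rateZ n m kn km sm)

end

/-!
The argument rests on Hamming cubes inside the parameter class. A family `θ e`, indexed by bit
vectors `e` of length `D`, whose squared Frobenius distances are `a` times the Hamming distances
(`HasCube`), forces every estimator to miss by a constant multiple of `σ² D / p`
(`le_minimaxDevProb_of_hasCube`). Indeed, with `a = σ² / (5 p)` all vertices have divergence at most
`D / 10` from a fixed one, so the probability that the estimator succeeds at `θ e` can be
transferred to that fixed vertex (`exp_mul_completionLaw_sub_le`). There the success events add up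
to at most the largest number of vertices in a ball, which is an exponentially small part of the
cube (`card_frobSq_lt_le`). Exponentiating the Gibbs variational inequality at inverse temperature
`D`, instead of taking logarithms, makes the comparison uniform in `D ≥ 1`. The change of measure is
the Cameron–Martin formula, with the noise shifted only where an entry is observed; this is where
the factor `p` in the divergence comes from.

Each summand of the rate is, up to a factor `3`, the dimension of a cube. A one-hot factor has
orthogonal columns, so after normalization it embeds matrices isometrically (`HasFrame`). One-hot
factors on both sides embed a cube in the free middle matrix, of dimension `r_n r_m`. For the first
factor there is nothing more to do if `n ≤ k_n`. Otherwise the bits are stored in the sparse rows: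
split the columns into `s` blocks and let each block hold the nonzero words of
`L ≈ log₂ (k / s + 1)` bits as rows of `B`; choosing at most one column per block writes `s L`
arbitrary bits (`rowCode_hammingNorm_le`). Dropping columns of `B` truncates the code to the
available `r_m` dimensions, so no packing or covering argument is needed. With exactly one nonzero
entry per row the `k` columns hold all words of `⌊log₂ k⌋` bits, and a single column needs a letter
other than `0` and `1`. The last factor is treated by transposition.
-/

/-! ### Change of measure for masked Gaussian noise -/

lemma gaussianReal_neg_eq_withDensity {v : NNReal} (hv : v ≠ 0) (c : ℝ) :
    gaussianReal (-c) v = (gaussianReal 0 v).withDensity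
      fun x => ENNReal.ofReal (Real.exp (-(c * x / v + c ^ 2 / (2 * v)))) := by
  have hv' : (v : ℝ) ≠ 0 := by exact_mod_cast hv
  rw [gaussianReal_of_var_ne_zero _ hv, gaussianReal_of_var_ne_zero _ hv,
    ← withDensity_mul _ (measurable_gaussianPDF 0 v) (by fun_prop)]
  congr 1
  funext x
  simp only [gaussianPDF, Pi.mul_apply]
  rw [← ENNReal.ofReal_mul (gaussianPDFReal_nonneg _ _ _), gaussianPDFReal, gaussianPDFReal,
    mul_assoc _ (Real.exp _), ← Real.exp_add]
  congr 3
  field_simp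
  ring

lemma pi_gaussianReal_neg_eq_withDensity {ι : Type*} [Fintype ι] {v : NNReal} (hv : v ≠ 0)
    (c : ι → ℝ) :
    Measure.pi (fun i => gaussianReal (-c i) v) =
      (Measure.pi fun _ : ι => gaussianReal 0 v).withDensity
        fun x => ENNReal.ofReal (Real.exp (-∑ i, (c i * x i / v + c i ^ 2 / (2 * v)))) := by
  refine Measure.pi_eq fun s hs => ?_
  rw [withDensity_apply _ (MeasurableSet.univ_pi hs),
    ← lintegral_indicator (MeasurableSet.univ_pi hs)]
  set f : ι → ℝ → ℝ≥0∞ := fun i => (s i).indicator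
    fun x => ENNReal.ofReal (Real.exp (-(c i * x / v + c i ^ 2 / (2 * v)))) with hf
  have hfm : ∀ i, Measurable (f i) := fun i => Measurable.indicator (by fun_prop) (hs i)
  have h1 : (Set.univ.pi s).indicator (fun x : ι → ℝ =>
      ENNReal.ofReal (Real.exp (-∑ i, (c i * x i / v + c i ^ 2 / (2 * v))))) =
      fun x => ∏ i, f i (x i) := by
    funext x
    by_cases hx : x ∈ Set.univ.pi s
    · rw [Set.indicator_of_mem hx, ← Finset.sum_neg_distrib, Real.exp_sum,
        ENNReal.ofReal_prod_of_nonneg fun _ _ => (Real.exp_pos _).le]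
      exact Finset.prod_congr rfl fun i _ => by
        simp [hf, hx i trivial]
    · rw [Set.indicator_of_notMem hx]
      obtain ⟨i, hi⟩ : ∃ i, x i ∉ s i := by simpa [Set.mem_pi] using hx
      exact (Finset.prod_eq_zero (Finset.mem_univ i) (Set.indicator_of_notMem hi _)).symm
  rw [h1, lintegral_prod_eq_prod_lintegral_of_indepFun Finset.univ
    (fun i (x : ι → ℝ) => f i (x i)) (iIndepFun_pi fun i => (hfm i).aemeasurable)
    fun i => (hfm i).comp (measurable_pi_apply i)]
  refine Finset.prod_congr rfl fun i _ => ?_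
  have h2 := (measurePreserving_eval (fun _ : ι => gaussianReal 0 v) i).lintegral_comp (hfm i)
  simp only [Function.eval] at h2
  rw [h2, hf, gaussianReal_neg_eq_withDensity hv, withDensity_apply _ (hs i),
    lintegral_indicator (hs i)]

/-- Cameron–Martin formula for centred Gaussian noise with independent coordinates: shifting the
noise by `c` is paid for by the exponential likelihood ratio. -/
lemma lintegral_pi_gaussianReal_shift {ι : Type*} [Fintype ι] {v : NNReal} (hv : v ≠ 0)
    (c : ι → ℝ) {F : (ι → ℝ) → ℝ≥0∞} (hF : Measurable F) :
    ∫⁻ x, F x ∂Measure.pi (fun _ : ι => gaussianReal 0 v) =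
      ∫⁻ x, ENNReal.ofReal (Real.exp (-∑ i, (c i * x i / v + c i ^ 2 / (2 * v)))) *
        F (fun i => x i + c i) ∂Measure.pi (fun _ : ι => gaussianReal 0 v) := by
  have h : Measure.pi (fun _ : ι => gaussianReal 0 v) =
      (Measure.pi fun i => gaussianReal (-c i) v).map fun x i => x i + c i := by
    rw [Measure.pi_map_pi fun i => (measurable_add_const (c i)).aemeasurable]
    simp [gaussianReal_map_add_const]
  have hm : Measurable fun (x : ι → ℝ) i => x i + c i := by fun_prop
  conv_lhs => rw [h, lintegral_map hF hm, pi_gaussianReal_neg_eq_withDensity hv c]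
  exact lintegral_withDensity_eq_lintegral_mul _ (by fun_prop) (hF.comp hm)

/-- Law of the mask and the noise from which `completionLaw` is built. -/
noncomputable def maskNoise (ι : Type*) [Fintype ι] (p : unitInterval) (v : NNReal) :
    Measure ((ι → ℝ) × (ι → ℝ)) :=
  (Measure.pi fun _ : ι => bernoulliMeasure (1 : ℝ) 0 p).prod
    (Measure.pi fun _ : ι => gaussianReal 0 v)

instance (ι : Type*) [Fintype ι] (p : unitInterval) (v : NNReal) :
    IsProbabilityMeasure (maskNoise ι p v) := by
  unfold maskNoise; infer_instance

lemma ae_pi_bernoulliMeasure_mem {ι : Type*} [Fintype ι] (p : unitInterval) :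
    ∀ᵐ e ∂Measure.pi (fun _ : ι => bernoulliMeasure (1 : ℝ) 0 p), ∀ i, e i = 0 ∨ e i = 1 := by
  rw [ae_all_iff]
  intro i
  have h : ∀ᵐ x ∂bernoulliMeasure (1 : ℝ) 0 p, x = 0 ∨ x = 1 := by
    rw [ae_iff]
    exact bernoulliMeasure_apply_of_notMem_of_notMem p
      ((measurableSet_singleton 0).union (measurableSet_singleton 1)).compl (by simp) (by simp)
  exact (measurePreserving_eval (fun _ : ι => bernoulliMeasure (1 : ℝ) 0 p)
    i).quasiMeasurePreserving.ae h

/-- The shift only acts where the mask is `1`; this is why the observation probability `p`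
enters the expected log-likelihood ratio. -/
lemma lintegral_maskNoise_shift {ι : Type*} [Fintype ι] (p : unitInterval) {v : NNReal}
    (hv : v ≠ 0) (θ δ : ι → ℝ) {F : (ι → ℝ) → ℝ≥0∞} (hF : Measurable F) :
    ∫⁻ ω, F (fun i => ω.1 i * (θ i + ω.2 i)) ∂maskNoise ι p v =
      ∫⁻ ω, ENNReal.ofReal (Real.exp (-∑ i, ((ω.1 i * δ i) * ω.2 i / v +
        (ω.1 i * δ i) ^ 2 / (2 * v)))) *
        F (fun i => ω.1 i * (θ i + δ i + ω.2 i)) ∂maskNoise ι p v := by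
  rw [maskNoise, lintegral_prod _ (by fun_prop), lintegral_prod _ (by fun_prop)]
  refine lintegral_congr_ae ?_
  filter_upwards [ae_pi_bernoulliMeasure_mem p] with e he
  rw [lintegral_pi_gaussianReal_shift hv (fun i => e i * δ i) (by fun_prop)]
  refine lintegral_congr fun x => ?_
  congr 3
  funext i
  rcases he i with h | h
  · simp [h]
  · simp [h]
    ring

/-- The expected log-likelihood ratio, that is, the Kullback–Leibler divergence. -/
lemma integrable_and_integral_logRatio {ι : Type*} [Fintype ι] (p : unitInterval) (v : NNReal)
    (δ : ι → ℝ) :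
    Integrable (fun ω : (ι → ℝ) × (ι → ℝ) => ∑ i, ((ω.1 i * δ i) * ω.2 i / v +
        (ω.1 i * δ i) ^ 2 / (2 * v))) (maskNoise ι p v) ∧
    ∫ ω, ∑ i, ((ω.1 i * δ i) * ω.2 i / v + (ω.1 i * δ i) ^ 2 / (2 * v)) ∂maskNoise ι p v =
      p * (∑ i, δ i ^ 2) / (2 * v) := by
  have hb : ∀ (f : ℝ → ℝ), Integrable f (bernoulliMeasure (1 : ℝ) 0 p) := by
    intro f
    rw [bernoulliMeasure_def]
    exact ((integrable_dirac (by simp)).smul_measure_nnreal).add_measure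
      ((integrable_dirac (by simp)).smul_measure_nnreal)
  have hg : Integrable (fun x : ℝ => x) (gaussianReal 0 v) :=
    (memLp_id_gaussianReal 1).integrable (by simp)
  have he : ∀ i, Integrable (fun e : ι → ℝ => e i)
      (Measure.pi fun _ : ι => bernoulliMeasure (1 : ℝ) 0 p) :=
    fun i => integrable_comp_eval (μ := fun _ : ι => bernoulliMeasure (1 : ℝ) 0 p)
      (f := fun x : ℝ => x) (hb _)
  have he2 : ∀ i, Integrable (fun e : ι → ℝ => e i ^ 2)
      (Measure.pi fun _ : ι => bernoulliMeasure (1 : ℝ) 0 p) :=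
    fun i => integrable_comp_eval (μ := fun _ : ι => bernoulliMeasure (1 : ℝ) 0 p)
      (f := fun x : ℝ => x ^ 2) (hb _)
  have hx : ∀ i, Integrable (fun e : ι → ℝ => e i) (Measure.pi fun _ : ι => gaussianReal 0 v) :=
    fun i => integrable_comp_eval (μ := fun _ : ι => gaussianReal 0 v) (f := fun x : ℝ => x) hg
  have h1 : ∀ i, Integrable (fun ω : (ι → ℝ) × (ι → ℝ) => ω.1 i * ω.2 i) (maskNoise ι p v) :=
    fun i => (he i).mul_prod (hx i)
  have h2 : ∀ i, Integrable (fun ω : (ι → ℝ) × (ι → ℝ) => ω.1 i ^ 2) (maskNoise ι p v) :=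
    fun i => (he2 i).comp_fst _
  have i1 : ∀ i, ∫ ω, ω.1 i * ω.2 i ∂maskNoise ι p v = 0 := by
    intro i
    rw [maskNoise, integral_prod_mul (fun e : ι → ℝ => e i) (fun x : ι → ℝ => x i),
      integral_comp_eval (μ := fun _ : ι => gaussianReal 0 v) (f := fun x : ℝ => x)
        hg.aestronglyMeasurable]
    simp
  have i2 : ∀ i, ∫ ω, ω.1 i ^ 2 ∂maskNoise ι p v = p := by
    intro i
    rw [maskNoise, integral_fun_fst (fun e : ι → ℝ => e i ^ 2),
      integral_comp_eval (μ := fun _ : ι => bernoulliMeasure (1 : ℝ) 0 p)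
        (f := fun x : ℝ => x ^ 2) (hb _).aestronglyMeasurable, integral_bernoulliMeasure]
    simp
  have e1 : ∀ (ω : (ι → ℝ) × (ι → ℝ)) i, (ω.1 i * δ i) * ω.2 i / v +
      (ω.1 i * δ i) ^ 2 / (2 * v) =
      δ i / v * (ω.1 i * ω.2 i) + δ i ^ 2 / (2 * v) * ω.1 i ^ 2 := fun ω i => by ring
  simp_rw [e1]
  have h3 : ∀ i, Integrable (fun ω : (ι → ℝ) × (ι → ℝ) =>
      δ i / v * (ω.1 i * ω.2 i) + δ i ^ 2 / (2 * v) * ω.1 i ^ 2) (maskNoise ι p v) :=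
    fun i => ((h1 i).const_mul _).add ((h2 i).const_mul _)
  refine ⟨integrable_finsetSum _ fun i _ => h3 i, ?_⟩
  rw [integral_finsetSum _ fun i _ => h3 i, Finset.mul_sum, Finset.sum_div]
  refine Finset.sum_congr rfl fun i _ => ?_
  rw [integral_add ((h1 i).const_mul _) ((h2 i).const_mul _), integral_const_mul,
    integral_const_mul, i1, i2]
  ring

lemma ofReal_exp_integral_le_lintegral {Ω : Type*} [MeasurableSpace Ω] {μ : Measure Ω}
    [IsProbabilityMeasure μ] {u : Ω → ℝ} (hu : Integrable u μ) :
    ENNReal.ofReal (Real.exp (∫ ω, u ω ∂μ)) ≤ ∫⁻ ω, ENNReal.ofReal (Real.exp (u ω)) ∂μ := by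
  by_cases h : ∫⁻ ω, ENNReal.ofReal (Real.exp (u ω)) ∂μ = ∞
  · simp [h]
  have hm : AEStronglyMeasurable (fun ω => Real.exp (u ω)) μ :=
    Real.continuous_exp.comp_aestronglyMeasurable hu.aestronglyMeasurable
  have hi : Integrable (fun ω => Real.exp (u ω)) μ :=
    ⟨hm, (hasFiniteIntegral_iff_ofReal (.of_forall fun _ => (Real.exp_pos _).le)).2
      (lt_top_iff_ne_top.2 h)⟩
  rw [← ofReal_integral_eq_lintegral_ofReal hi (.of_forall fun _ => (Real.exp_pos _).le)]
  exact ENNReal.ofReal_le_ofReal (convexOn_exp.map_integral_le Real.continuous_exp.continuousOn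
    isClosed_univ (by simp) hu hi)

lemma measurable_maskedObservation {n m : ℕ} (θ : Matrix (Fin n) (Fin m) ℝ) :
    Measurable fun ω : (Fin n × Fin m → ℝ) × (Fin n × Fin m → ℝ) =>
      (Matrix.of fun i j => ω.1 (i, j) * (θ i j + ω.2 (i, j)) : Matrix (Fin n) (Fin m) ℝ) := by
  refine measurable_pi_lambda _ fun i => measurable_pi_lambda _ fun j => ?_
  show Measurable fun ω : (Fin n × Fin m → ℝ) × (Fin n × Fin m → ℝ) =>
    ω.1 (i, j) * (θ i j + ω.2 (i, j))
  fun_prop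

instance {n m : ℕ} (p : unitInterval) (σ : ℝ) (θ : Matrix (Fin n) (Fin m) ℝ) :
    IsProbabilityMeasure (completionLaw p σ θ) :=
  Measure.isProbabilityMeasure_map (μ := maskNoise (Fin n × Fin m) p (σ ^ 2).toNNReal)
    (measurable_maskedObservation θ).aemeasurable

lemma lintegral_exp_indicator {Ω : Type*} [MeasurableSpace Ω] {μ : Measure Ω}
    [IsProbabilityMeasure μ] {A : Set Ω} (hA : MeasurableSet A) (l : ℝ) :
    ∫⁻ ω, ENNReal.ofReal (Real.exp (A.indicator (fun _ => l) ω)) ∂μ =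
      ENNReal.ofReal (1 + (Real.exp l - 1) * μ.real A) := by
  have h : (fun ω => Real.exp (A.indicator (fun _ => l) ω)) =
      fun ω => 1 + A.indicator (fun _ => Real.exp l - 1) ω := by
    funext ω
    by_cases h : ω ∈ A <;> simp [h]
  have hi : Integrable (A.indicator fun _ => Real.exp l - 1) μ :=
    (integrable_const _).indicator hA
  have hi' : Integrable (fun ω => 1 + A.indicator (fun _ => Real.exp l - 1) ω) μ :=
    (integrable_const _).add hi
  rw [← ofReal_integral_eq_lintegral_ofReal (h ▸ hi') (.of_forall fun _ => (Real.exp_pos _).le), h,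
    integral_add (integrable_const _) hi, integral_indicator_const _ hA]
  simp [mul_comm]

/-- Change of measure in exponential form: the Gibbs variational inequality for the event `A`,
combined with the bound `p ‖θ₁ - θ₀‖² / (2 σ²)` on the Kullback–Leibler divergence. -/
lemma exp_mul_completionLaw_sub_le {n m : ℕ} (p : unitInterval) {σ : ℝ} (hσ : 0 < σ)
    (θ₀ θ₁ : Matrix (Fin n) (Fin m) ℝ) {A : Set (Matrix (Fin n) (Fin m) ℝ)}
    (hA : MeasurableSet A) (l : ℝ) :
    Real.exp (l * (completionLaw p σ θ₁).real A - p * frobSq (θ₁ - θ₀) / (2 * σ ^ 2)) ≤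
      1 + (Real.exp l - 1) * (completionLaw p σ θ₀).real A := by
  set v : NNReal := (σ ^ 2).toNNReal with hv
  have hvσ : (v : ℝ) = σ ^ 2 := Real.coe_toNNReal _ (by positivity)
  have hv0 : v ≠ 0 := by
    rw [← NNReal.coe_ne_zero, hvσ]; positivity
  set μ := maskNoise (Fin n × Fin m) p v with hμ
  set Y : Matrix (Fin n) (Fin m) ℝ → (Fin n × Fin m → ℝ) × (Fin n × Fin m → ℝ) →
    Matrix (Fin n) (Fin m) ℝ := fun θ ω => Matrix.of fun i j => ω.1 (i, j) * (θ i j + ω.2 (i, j))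
    with hY
  have hYm : ∀ θ, Measurable (Y θ) := measurable_maskedObservation
  have hlaw : ∀ θ, completionLaw p σ θ = μ.map (Y θ) := fun _ => rfl
  set δ : Fin n × Fin m → ℝ := fun i => θ₁ i.1 i.2 - θ₀ i.1 i.2 with hδ
  set W : (Fin n × Fin m → ℝ) × (Fin n × Fin m → ℝ) → ℝ := fun ω =>
    ∑ i, ((ω.1 i * δ i) * ω.2 i / v + (ω.1 i * δ i) ^ 2 / (2 * v)) with hW
  obtain ⟨hWi, hWe⟩ := integrable_and_integral_logRatio p v δ
  have hδs : ∑ i, δ i ^ 2 = frobSq (θ₁ - θ₀) := by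
    rw [Fintype.sum_prod_type]; rfl
  set f : Matrix (Fin n) (Fin m) ℝ → ℝ := A.indicator fun _ => l with hf
  have hfm : Measurable f := measurable_const.indicator hA
  have hcurry : Measurable fun y : Fin n × Fin m → ℝ =>
      (Matrix.of fun i j => y (i, j) : Matrix (Fin n) (Fin m) ℝ) := by
    refine measurable_pi_lambda _ fun i => measurable_pi_lambda _ fun j => ?_
    exact measurable_pi_apply (i, j)
  have hshift : ∫⁻ ω, ENNReal.ofReal (Real.exp (f (Y θ₀ ω))) ∂μ =
      ∫⁻ ω, ENNReal.ofReal (Real.exp (f (Y θ₁ ω) - W ω)) ∂μ := by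
    have h := lintegral_maskNoise_shift p hv0 (fun i : Fin n × Fin m => θ₀ i.1 i.2) δ
      (F := fun y => ENNReal.ofReal (Real.exp (f (Matrix.of fun i j => y (i, j)))))
      (by fun_prop)
    refine h.trans (lintegral_congr fun ω => ?_)
    rw [← ENNReal.ofReal_mul (Real.exp_pos _).le, ← Real.exp_add]
    congr 2
    rw [sub_eq_add_neg, add_comm]
    congr 2
    ext i j
    simp [hY, hδ]
  have hint : Integrable (fun ω => f (Y θ₁ ω)) μ := by
    have : (fun ω => f (Y θ₁ ω)) = (Y θ₁ ⁻¹' A).indicator fun _ => l := by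
      rfl
    rw [this]
    exact (integrable_const _).indicator (hYm θ₁ hA)
  have hintv : ∫ ω, f (Y θ₁ ω) ∂μ = l * (completionLaw p σ θ₁).real A := by
    rw [← integral_map (hYm θ₁).aemeasurable hfm.aestronglyMeasurable, ← hlaw, hf,
      integral_indicator_const _ hA, smul_eq_mul, mul_comm]
  have hJ := ofReal_exp_integral_le_lintegral (hint.sub hWi)
  have h0 : ∫⁻ ω, ENNReal.ofReal (Real.exp (f (Y θ₀ ω))) ∂μ =
      ENNReal.ofReal (1 + (Real.exp l - 1) * (completionLaw p σ θ₀).real A) := by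
    rw [← lintegral_exp_indicator hA l, hlaw θ₀, lintegral_map (by fun_prop) (hYm θ₀)]
  simp only [Pi.sub_apply] at hJ
  rw [← hW, ← hμ] at *
  rw [← hshift, h0, integral_sub hint hWi, hintv, hWe, hδs, hvσ] at hJ
  refine (ENNReal.ofReal_le_ofReal_iff ?_).1 hJ
  have h1 : (completionLaw p σ θ₀).real A ≤ 1 := measureReal_le_one
  have h2 : 0 ≤ (completionLaw p σ θ₀).real A := measureReal_nonneg
  nlinarith [Real.exp_pos l]

/-! ### Hypercubes in the parameter set -/

/-- Few vertices of the discrete cube lie within Hamming distance `D / 20` of a given one: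
an exponential Markov bound with weight `(9/10) ^ 20` per disagreement. -/
lemma card_hammingDist_le {ι : Type*} [Fintype ι] [DecidableEq ι] (e : ι → Bool) :
    (((Finset.univ.filter fun e' : ι → Bool => 20 * hammingDist e' e ≤ Fintype.card ι).card : ℕ)
      : ℝ) ≤ (2 * (624 / 1000)) ^ Fintype.card ι := by
  set D := Fintype.card ι with hD
  set y : ℝ := 9 / 10
  have hy0 : 0 < y := by norm_num [y]
  have hsum : ∑ e' : ι → Bool, (y ^ 20) ^ hammingDist e' e = (1 + y ^ 20) ^ D := by
    have : ∀ e' : ι → Bool, (y ^ 20) ^ hammingDist e' e =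
        ∏ i, if e' i ≠ e i then y ^ 20 else 1 := by
      intro e'
      rw [Finset.prod_ite, Finset.prod_const, Finset.prod_const_one, mul_one]
      rfl
    simp_rw [this]
    rw [← Fintype.piFinset_univ, ← Finset.prod_univ_sum (fun _ => Finset.univ)
      fun i b => if b ≠ e i then y ^ 20 else 1]
    rw [Finset.prod_congr rfl (g := fun _ => 1 + y ^ 20), Finset.prod_const, Finset.card_univ]
    intro i _
    cases h : e i <;> simp [add_comm]
  have h1 : (((Finset.univ.filter fun e' : ι → Bool => 20 * hammingDist e' e ≤ D).card : ℕ) : ℝ)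
      * y ^ D ≤ (1 + y ^ 20) ^ D := by
    rw [← hsum, ← nsmul_eq_mul, ← Finset.sum_const]
    refine (Finset.sum_le_sum fun e' he' => ?_).trans
      (Finset.sum_le_sum_of_subset_of_nonneg (Finset.filter_subset _ _) fun _ _ _ => by positivity)
    rw [← pow_mul]
    exact pow_le_pow_of_le_one hy0.le (by norm_num [y]) (Finset.mem_filter.1 he').2
  rw [← le_div_iff₀ (by positivity), ← div_pow] at h1
  refine h1.trans (pow_le_pow_left₀ (by positivity) ?_ _)
  norm_num [y]

lemma one_add_pow_sub_one_mul_pow_le {E r : ℝ} (hE : 1 ≤ E) (hr : 0 ≤ r) (hr1 : r ≤ 1) {D : ℕ}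
    (hD : D ≠ 0) : 1 + (E ^ D - 1) * r ^ D ≤ (1 + (E - 1) * r) ^ D := by
  induction D, Nat.one_le_iff_ne_zero.2 hD using Nat.le_induction with
  | base => simp
  | succ D hD' ih =>
    have ih := ih (by omega)
    rw [pow_succ (1 + (E - 1) * r)]
    have h0 : 0 ≤ 1 + (E - 1) * r := by nlinarith
    refine le_trans ?_ (mul_le_mul_of_nonneg_right ih h0)
    have h1 : 1 ≤ E ^ D := one_le_pow₀ hE
    have h2 : r ^ (D + 1) ≤ r := pow_le_of_le_one hr hr1 (by omega)
    have h3 : r ^ (D + 1) ≤ r ^ D := pow_le_pow_of_le_one hr hr1 (by omega)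
    have h4 : (1 + (E ^ D - 1) * r ^ D) * (1 + (E - 1) * r) -
          (1 + (E ^ (D + 1) - 1) * r ^ (D + 1)) =
        (E - 1) * (r - r ^ (D + 1)) + (E ^ D - 1) * (r ^ D - r ^ (D + 1)) := by ring
    nlinarith [mul_nonneg (sub_nonneg.2 hE) (sub_nonneg.2 h2),
      mul_nonneg (sub_nonneg.2 h1) (sub_nonneg.2 h3)]

lemma one_add_mul_lt_exp : 1 + (Real.exp 1 - 1) * (624 / 1000) < Real.exp (8 / 10) := by
  have h1 := Real.exp_one_lt_d9
  have h2 := Real.exp_one_gt_d9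
  have h3 : Real.exp (8 / 10) ^ 5 = Real.exp 1 ^ 4 := by
    rw [← Real.exp_nat_mul, ← Real.exp_nat_mul]; norm_num
  refine lt_of_pow_lt_pow_left₀ 5 (Real.exp_pos _).le ?_
  rw [h3]
  calc (1 + (Real.exp 1 - 1) * (624 / 1000)) ^ 5 ≤ (21 / 10 : ℝ) ^ 5 :=
        pow_le_pow_left₀ (by nlinarith) (by linarith) _
    _ < (27 / 10 : ℝ) ^ 4 := by norm_num
    _ ≤ Real.exp 1 ^ 4 := pow_le_pow_left₀ (by norm_num) (by linarith) _

/-- `Θ` contains Hamming cubes with coordinates `ι` at every scale: families of parameters indexed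
by bit vectors whose squared distances are proportional to Hamming distances, with any positive
factor `a`. -/
def HasCube {n m : ℕ} (Θ : Set (Matrix (Fin n) (Fin m) ℝ)) (ι : Type) [Fintype ι] : Prop :=
  ∀ a : ℝ, 0 < a → ∃ θ : (ι → Bool) → Matrix (Fin n) (Fin m) ℝ, (∀ e, θ e ∈ Θ) ∧
    ∀ e e', frobSq (θ e - θ e') = a * hammingDist e e'

lemma frobSq_nonneg {n m : ℕ} (A : Matrix (Fin n) (Fin m) ℝ) : 0 ≤ frobSq A :=
  Finset.sum_nonneg fun _ _ => Finset.sum_nonneg fun _ _ => sq_nonneg _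

lemma frobSq_sub_le {n m : ℕ} (v A B : Matrix (Fin n) (Fin m) ℝ) :
    frobSq (A - B) ≤ 2 * frobSq (v - A) + 2 * frobSq (v - B) := by
  simp only [frobSq, Finset.mul_sum, ← Finset.sum_add_distrib]
  refine Finset.sum_le_sum fun i _ => Finset.sum_le_sum fun j _ => ?_
  simp only [Matrix.sub_apply]
  nlinarith [sq_nonneg ((v i j - A i j) + (v i j - B i j))]

lemma measurable_frobSq_sub {n m : ℕ}
    {ϑ : Matrix (Fin n) (Fin m) ℝ → Matrix (Fin n) (Fin m) ℝ} (hϑ : Measurable ϑ)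
    (θ : Matrix (Fin n) (Fin m) ℝ) : Measurable fun y => frobSq (ϑ y - θ) := by
  unfold frobSq
  refine Finset.measurable_sum _ fun i _ => Finset.measurable_sum _ fun j _ => ?_
  have : Measurable fun y => ϑ y i j :=
    (measurable_pi_apply j).comp ((measurable_pi_apply i).comp hϑ)
  simpa using (this.sub_const (θ i j)).pow_const 2

/-- Whatever the estimator reports, only an exponentially small proportion of the vertices of a
cube is within the target distance of the report. -/
lemma card_frobSq_lt_le {n m : ℕ} {ι : Type} [Fintype ι] [DecidableEq ι] {a t : ℝ} (ha : 0 < a)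
    (ht : 4 * t ≤ a * Fintype.card ι / 20) {θ : (ι → Bool) → Matrix (Fin n) (Fin m) ℝ}
    (hθ : ∀ e e', frobSq (θ e - θ e') = a * hammingDist e e') (v : Matrix (Fin n) (Fin m) ℝ) :
    ((Finset.univ.filter fun e => frobSq (v - θ e) < t).card : ℝ) ≤
      (2 * (624 / 1000)) ^ Fintype.card ι := by
  rcases (Finset.univ.filter fun e => frobSq (v - θ e) < t).eq_empty_or_nonempty with h | ⟨e₀, h₀⟩
  · rw [h]; simp only [Finset.card_empty, Nat.cast_zero]; positivity
  · refine le_trans (Nat.cast_le.2 (Finset.card_le_card fun e he => ?_)) (card_hammingDist_le e₀)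
    simp only [Finset.mem_filter, Finset.mem_univ, true_and] at h₀ he ⊢
    have h1 := frobSq_sub_le v (θ e) (θ e₀)
    rw [hθ] at h1
    have h2 : a * (20 * hammingDist e e₀) ≤ a * Fintype.card ι := by linarith
    exact_mod_cast le_of_mul_le_mul_left h2 ha

/-- Fano-type lower bound: if the parameter set contains Hamming cubes of dimension `D`, no
estimator beats `σ² D / (400 p)` with probability above `9/10`. Squared side lengths `σ² / (5 p)`
keep the divergence between any two vertices below `D / 10`. -/
theorem le_minimaxDevProb_of_hasCube {n m : ℕ} {ι : Type} [Fintype ι]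
    {Θ : Set (Matrix (Fin n) (Fin m) ℝ)} (h : HasCube Θ ι) {p : unitInterval} (hp : 0 < p)
    {σ : ℝ} (hσ : 0 < σ) {t : ℝ} (ht : t ≤ σ ^ 2 / p * Fintype.card ι / 400) :
    1 / 10 ≤ minimaxDevProb p σ Θ t := by
  classical
  have hp' : (0 : ℝ) < p := hp
  set D := Fintype.card ι with hD
  set a : ℝ := σ ^ 2 / (5 * p) with ha
  have ha0 : 0 < a := by positivity
  obtain ⟨θ, hθΘ, hθ⟩ := h a ha0
  refine le_iInf₂ fun ϑ hϑ => ?_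
  by_contra! hlt
  have hlt' : ∀ e, completionLaw p σ (θ e) {y | t ≤ frobSq (ϑ y - θ e)} < 1 / 10 := fun e =>
    (le_iSup₂ (f := fun θ (_ : θ ∈ Θ) => completionLaw p σ θ {y | t ≤ frobSq (ϑ y - θ)})
      (θ e) (hθΘ e)).trans_lt hlt
  set A : (ι → Bool) → Set (Matrix (Fin n) (Fin m) ℝ) := fun e =>
    {y | frobSq (ϑ y - θ e) < t} with hA
  have hAm : ∀ e, MeasurableSet (A e) := fun e =>
    measurableSet_lt (measurable_frobSq_sub hϑ _) measurable_const
  have hbig : ∀ e, 9 / 10 ≤ (completionLaw p σ (θ e)).real (A e) := by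
    intro e
    have h1 : (A e)ᶜ = {y | t ≤ frobSq (ϑ y - θ e)} := by ext y; simp [hA]
    have h2 := probReal_compl_eq_one_sub (μ := completionLaw p σ (θ e)) (hAm e)
    rw [h1] at h2
    have h3 : (completionLaw p σ (θ e)).real {y | t ≤ frobSq (ϑ y - θ e)} ≤ 1 / 10 := by
      have := ENNReal.toReal_mono (by simp) (hlt' e).le
      simpa [measureReal_def] using this
    linarith
  -- A dimension-zero cube is a single point, and then `t ≤ 0` makes the deviation event certain.
  have hD0 : D ≠ 0 := by
    intro h0
    have ht0 : t ≤ 0 := by simpa [h0] using ht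
    have : A (fun _ => false) = ∅ := by
      ext y
      simpa [hA] using ht0.trans (frobSq_nonneg _)
    have h2 := hbig fun _ => false
    rw [this] at h2
    norm_num at h2
  set e₀ : ι → Bool := fun _ => false
  set P := completionLaw p σ (θ e₀) with hP
  have hcm : ∀ e, Real.exp (8 / 10) ^ D ≤ 1 + (Real.exp 1 ^ D - 1) * P.real (A e) := by
    intro e
    have h1 := exp_mul_completionLaw_sub_le p hσ (θ e₀) (θ e) (hAm e) (D : ℝ)
    rw [← Real.exp_nat_mul, ← Real.exp_nat_mul, mul_one]
    refine le_trans (Real.exp_le_exp.2 ?_) h1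
    have h2 : (p : ℝ) * frobSq (θ e - θ e₀) / (2 * σ ^ 2) = (hammingDist e e₀ : ℝ) / 10 := by
      rw [hθ, ha]; field_simp; ring
    have h3 : (hammingDist e e₀ : ℝ) ≤ D := by exact_mod_cast hammingDist_le_card_fintype
    have h4 : (D : ℝ) * (9 / 10) ≤ D * (completionLaw p σ (θ e)).real (A e) :=
      mul_le_mul_of_nonneg_left (hbig e) (Nat.cast_nonneg _)
    rw [h2]
    linarith
  have hsum : ∑ e, P.real (A e) ≤ (2 * (624 / 1000)) ^ D := by
    have hi : ∀ e, Integrable ((A e).indicator fun _ => (1 : ℝ)) P := fun e =>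
      (integrable_const _).indicator (hAm e)
    have h1 : ∑ e, P.real (A e) = ∫ y, ∑ e, (A e).indicator (fun _ => (1 : ℝ)) y ∂P := by
      rw [integral_finsetSum _ fun e _ => hi e]
      simp [integral_indicator_const _ (hAm _)]
    rw [h1]
    refine (integral_mono (integrable_finsetSum _ fun e _ => hi e)
      (integrable_const ((2 * (624 / 1000)) ^ D)) fun y => ?_).trans (by simp)
    refine le_trans (le_of_eq ?_) (card_frobSq_lt_le ha0 (t := t) ?_ hθ (ϑ y))
    · simp [hA, Set.indicator]
    · rw [ha, ← hD]
      have : σ ^ 2 / (5 * p) * D / 20 = 4 * (σ ^ 2 / p * D / 400) := by field_simp; norm_num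
      linarith
  have hE : (1 : ℝ) ≤ Real.exp 1 := by linarith [Real.exp_one_gt_d9]
  have htot : (2 : ℝ) ^ D * Real.exp (8 / 10) ^ D ≤
      2 ^ D * (1 + (Real.exp 1 ^ D - 1) * (624 / 1000) ^ D) := by
    have h1 := Finset.sum_le_sum fun e (_ : e ∈ Finset.univ) => hcm e
    rw [Finset.sum_add_distrib, ← Finset.mul_sum] at h1
    simp only [Finset.sum_const, Finset.card_univ, Fintype.card_fun, Fintype.card_bool,
      nsmul_eq_mul, Nat.cast_pow, Nat.cast_ofNat, mul_one, ← hD] at h1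
    have h2 := mul_le_mul_of_nonneg_left hsum
      (sub_nonneg.2 (one_le_pow₀ hE : (1 : ℝ) ≤ Real.exp 1 ^ D))
    rw [mul_pow] at h2
    linarith
  have h1 := le_of_mul_le_mul_left htot (by positivity)
  have h2 := one_add_pow_sub_one_mul_pow_le hE (by norm_num : (0 : ℝ) ≤ 624 / 1000)
    (by norm_num) hD0
  have h3 := pow_lt_pow_left₀ one_add_mul_lt_exp (by linarith) hD0
  linarith

/-- Markov's inequality turns a bound in probability into a bound on the risk. -/
lemma ofReal_le_minimaxSqRisk {n m : ℕ} {Θ : Set (Matrix (Fin n) (Fin m) ℝ)} {p : unitInterval}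
    {σ t : ℝ} (h : 1 / 10 ≤ minimaxDevProb p σ Θ t) :
    ENNReal.ofReal (t / 10) ≤ minimaxSqRisk p σ Θ := by
  refine le_iInf₂ fun ϑ hϑ => ?_
  have h1 : 1 / 10 ≤ ⨆ θ ∈ Θ, completionLaw p σ θ {y | t ≤ frobSq (ϑ y - θ)} :=
    h.trans (iInf₂_le ϑ hϑ)
  calc ENNReal.ofReal (t / 10) = ENNReal.ofReal t * (1 / 10) := by
        rw [ENNReal.ofReal_div_of_pos (by norm_num), div_eq_mul_one_div]; norm_num
    _ ≤ ENNReal.ofReal t * ⨆ θ ∈ Θ, completionLaw p σ θ {y | t ≤ frobSq (ϑ y - θ)} := by gcongr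
    _ ≤ _ := by
        simp_rw [ENNReal.mul_iSup]
        refine iSup₂_mono fun θ _ => ?_
        refine le_trans ?_ (mul_meas_ge_le_lintegral
          (measurable_frobSq_sub hϑ θ).ennreal_ofReal (ENNReal.ofReal t))
        exact mul_le_mul_right (measure_mono fun y hy => ENNReal.ofReal_le_ofReal hy) _

lemma minimaxDevProb_anti {n m : ℕ} {Θ : Set (Matrix (Fin n) (Fin m) ℝ)} {p : unitInterval}
    {σ t t' : ℝ} (h : t ≤ t') : minimaxDevProb p σ Θ t' ≤ minimaxDevProb p σ Θ t :=
  iInf₂_mono fun _ _ => iSup₂_mono fun _ _ => measure_mono fun _ hy => h.trans hy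

/-! ### Cubes of factorized matrices -/

/-- All products `X B Zᵀ` with `X ∈ 𝒳`, `Z ∈ 𝒵` and `B` arbitrary. -/
def productClass {n m k l : ℕ} (X : Set (Matrix (Fin n) (Fin k) ℝ))
    (Z : Set (Matrix (Fin m) (Fin l) ℝ)) : Set (Matrix (Fin n) (Fin m) ℝ) :=
  {θ | ∃ A ∈ X, ∃ B : Matrix (Fin k) (Fin l) ℝ, ∃ C ∈ Z, θ = A * B * C.transpose}

/-- Some factor `Z ∈ 𝒵` has a `d`-dimensional orthonormal family in the row space of `Zᵀ`; the
matrix `S` gives the coefficients, so that `A ↦ A S Zᵀ` is an isometry for the Frobenius norm. -/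
def HasFrame {m k : ℕ} (Z : Set (Matrix (Fin m) (Fin k) ℝ)) (d : ℕ) : Prop :=
  ∃ C ∈ Z, ∃ S : Matrix (Fin d) (Fin k) ℝ, S * C.transpose * (S * C.transpose).transpose = 1

lemma frobSq_eq_trace {n m : ℕ} (A : Matrix (Fin n) (Fin m) ℝ) :
    frobSq A = (A * A.transpose).trace := by
  simp [frobSq, Matrix.trace, Matrix.mul_apply, sq]

lemma frobSq_transpose {n m : ℕ} (A : Matrix (Fin n) (Fin m) ℝ) :
    frobSq A.transpose = frobSq A := by
  simp only [frobSq, Matrix.transpose_apply]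
  exact Finset.sum_comm

lemma frobSq_mul_of_orthonormal {n m d : ℕ} (A : Matrix (Fin n) (Fin d) ℝ)
    {V : Matrix (Fin d) (Fin m) ℝ} (hV : V * V.transpose = 1) : frobSq (A * V) = frobSq A := by
  rw [frobSq_eq_trace, frobSq_eq_trace, Matrix.transpose_mul, Matrix.mul_assoc,
    ← Matrix.mul_assoc V, hV, Matrix.one_mul]

lemma frobSq_bits_sub {n d : ℕ} (a : ℝ) (ha : 0 ≤ a) (e e' : Fin n × Fin d → Bool) :
    frobSq (Matrix.of fun i j => √a * ((if e (i, j) then 1 else 0) -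
      (if e' (i, j) then 1 else 0)) : Matrix (Fin n) (Fin d) ℝ) = a * hammingDist e e' := by
  rw [hammingDist, Finset.card_filter, Nat.cast_sum, Finset.mul_sum, Fintype.sum_prod_type]
  refine Finset.sum_congr rfl fun i _ => Finset.sum_congr rfl fun j _ => ?_
  rw [Matrix.of_apply, mul_pow, Real.sq_sqrt ha]
  cases e (i, j) <;> cases e' (i, j) <;> simp

lemma HasCube.transpose {n m k l : ℕ} {X : Set (Matrix (Fin n) (Fin k) ℝ)}
    {Z : Set (Matrix (Fin m) (Fin l) ℝ)} {ι : Type} [Fintype ι]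
    (h : HasCube (productClass Z X) ι) : HasCube (productClass X Z) ι := by
  intro a ha
  obtain ⟨θ, h1, h2⟩ := h a ha
  refine ⟨fun e => (θ e).transpose, fun e => ?_, fun e e' => ?_⟩
  · obtain ⟨A, hA, B, C, hC, h⟩ := h1 e
    refine ⟨C, hC, B.transpose, A, hA, ?_⟩
    simp only [h, Matrix.transpose_mul, Matrix.transpose_transpose, Matrix.mul_assoc]
  · rw [← Matrix.transpose_sub, frobSq_transpose, h2]

/-- The middle factor is free, so frames on both sides embed a full cube of matrices `B`. -/
lemma HasFrame.hasCube {n m k l r d : ℕ} {X : Set (Matrix (Fin n) (Fin k) ℝ)}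
    {Z : Set (Matrix (Fin m) (Fin l) ℝ)} (hX : HasFrame X r) (hZ : HasFrame Z d) :
    HasCube (productClass X Z) (Fin r × Fin d) := by
  intro a ha
  obtain ⟨A, hA, T, hT⟩ := hX
  obtain ⟨C, hC, S, hS⟩ := hZ
  set G : (Fin r × Fin d → Bool) → Matrix (Fin r) (Fin d) ℝ := fun e =>
    Matrix.of fun i j => √a * (if e (i, j) then 1 else 0) with hG
  refine ⟨fun e => A * (T.transpose * G e * S) * C.transpose, fun e => ⟨A, hA, _, C, hC, rfl⟩,
    fun e e' => ?_⟩
  have h1 : A * (T.transpose * G e * S) * C.transpose - A * (T.transpose * G e' * S) * C.transpose =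
      ((G e - G e').transpose * (T * A.transpose)).transpose * (S * C.transpose) := by
    simp only [Matrix.transpose_mul, Matrix.transpose_transpose, Matrix.mul_sub, Matrix.sub_mul,
      Matrix.mul_assoc]
  rw [h1, frobSq_mul_of_orthonormal _ hS, frobSq_transpose, frobSq_mul_of_orthonormal _ hT,
    frobSq_transpose, ← frobSq_bits_sub a ha.le]
  congr 1
  ext i j
  simp [hG, mul_sub]

/-- The bits indexed by `κ` can be written linearly by admissible rows: for some matrix `B`, every
bit vector `e` is, up to a fixed offset `u`, the product of `B` with a row from `R`. -/
def RowCode {k : ℕ} (R : Set (Fin k → ℝ)) (κ : Type) : Prop :=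
  ∃ (x : (κ → Bool) → Fin k → ℝ) (B : Matrix (Fin k) κ ℝ) (u : κ → ℝ), (∀ e, x e ∈ R) ∧
    ∀ e j, ∑ i, x e i * B i j = u j + if e j then 1 else 0

lemma RowCode.comp {k : ℕ} {R : Set (Fin k → ℝ)} {κ κ' : Type} (h : RowCode R κ) (g : κ' ↪ κ) :
    RowCode R κ' := by
  obtain ⟨x, B, u, h1, h2⟩ := h
  refine ⟨fun e => x (Function.extend g e fun _ => false), B.submatrix id g, u ∘ g,
    fun e => h1 _, fun e j => ?_⟩
  have := h2 (Function.extend g e fun _ => false) (g j)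
  rw [g.injective.extend_apply] at this
  exact this

/-- A row code of `d` bits and a frame of dimension `d` on the other side store `d` independent
bits in each of the `n` rows. -/
lemma RowCode.hasCube {n m k l d : ℕ} {R : Set (Fin k → ℝ)} {X : Set (Matrix (Fin n) (Fin k) ℝ)}
    {Z : Set (Matrix (Fin m) (Fin l) ℝ)} (hR : RowCode R (Fin d))
    (hX : ∀ A : Matrix (Fin n) (Fin k) ℝ, (∀ i, A i ∈ R) → A ∈ X) (hZ : HasFrame Z d) :
    HasCube (productClass X Z) (Fin n × Fin d) := by
  intro a ha
  obtain ⟨x, B, u, h1, h2⟩ := hR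
  obtain ⟨C, hC, S, hS⟩ := hZ
  set A : (Fin n × Fin d → Bool) → Matrix (Fin n) (Fin k) ℝ := fun e =>
    Matrix.of fun i => x fun j => e (i, j) with hA
  refine ⟨fun e => A e * ((√a • B) * S) * C.transpose, fun e => ⟨A e, hX _ fun i => h1 _, _, C, hC,
    rfl⟩, fun e e' => ?_⟩
  have h3 : A e * ((√a • B) * S) * C.transpose - A e' * ((√a • B) * S) * C.transpose =
      (A e * (√a • B) - A e' * (√a • B)) * (S * C.transpose) := by
    simp only [Matrix.sub_mul, Matrix.mul_assoc]
  rw [h3, frobSq_mul_of_orthonormal _ hS, ← frobSq_bits_sub a ha.le]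
  congr 1
  ext i j
  have h4 : ∀ e, (A e * (√a • B)) i j = √a * (u j + if e (i, j) then 1 else 0) := by
    intro e
    rw [Matrix.mul_smul, Matrix.smul_apply, Matrix.mul_apply, smul_eq_mul]
    exact congrArg _ (h2 (fun j => e (i, j)) j)
  rw [Matrix.sub_apply, h4, h4, Matrix.of_apply]
  ring

/-! ### Frames from one-hot factors -/

/-- The matrix whose row `i` is the standard basis vector number `c i`. -/
def oneHot {m k : ℕ} (c : Fin m → Fin k) : Matrix (Fin m) (Fin k) ℝ :=
  Matrix.of fun i j => if j = c i then 1 else 0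

lemma hammingNorm_oneHot {m k : ℕ} (c : Fin m → Fin k) (i : Fin m) :
    hammingNorm (oneHot c i) = 1 := by
  simp only [hammingNorm, oneHot, Matrix.of_apply, ne_eq, ite_eq_right_iff, one_ne_zero, imp_false,
    not_not]
  rw [Finset.card_eq_one]
  exact ⟨c i, by ext; simp⟩

/-- The columns of a one-hot matrix are orthogonal; normalizing the nonzero ones by the sizes of
the fibres of `c` gives the frame. -/
lemma HasFrame.of_oneHot {m k d : ℕ} {Z : Set (Matrix (Fin m) (Fin k) ℝ)} {c : Fin m → Fin k}
    (hZ : oneHot c ∈ Z) (hc : ∀ l < d, ∃ i, (c i : ℕ) = l) : HasFrame Z d := by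
  set w : ℕ → ℝ := fun l => ∑ j, if (c j : ℕ) = l then 1 else 0 with hw
  have hw0 : ∀ l < d, 0 < w l := by
    intro l hl
    obtain ⟨i, hi⟩ := hc l hl
    exact Finset.sum_pos' (fun j _ => by split_ifs <;> norm_num)
      ⟨i, Finset.mem_univ i, by simp [hi]⟩
  refine ⟨oneHot c, hZ, Matrix.of fun l j => if (j : ℕ) = l then (√(w l))⁻¹ else 0, ?_⟩
  have h1 : ∀ (l : Fin d) (j : Fin m), ((Matrix.of fun (l : Fin d) (j : Fin k) =>
      if (j : ℕ) = l then (√(w l))⁻¹ else 0) * (oneHot c).transpose) l j =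
      if (c j : ℕ) = l then (√(w l))⁻¹ else 0 := by
    intro l j
    simp [Matrix.mul_apply, oneHot]
  ext l l'
  rw [Matrix.mul_apply]
  simp_rw [Matrix.transpose_apply, h1]
  by_cases h : l = l'
  · subst h
    have h2 : ∀ j, ((if (c j : ℕ) = l then (√(w l))⁻¹ else 0) *
        if (c j : ℕ) = l then (√(w l))⁻¹ else 0) =
        (w l)⁻¹ * if (c j : ℕ) = l then 1 else 0 := by
      intro j
      split_ifs
      · rw [← mul_inv, Real.mul_self_sqrt (hw0 l l.2).le, mul_one]
      · simp
    rw [Finset.sum_congr rfl fun j _ => h2 j, ← Finset.mul_sum, Matrix.one_apply_eq]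
    exact inv_mul_cancel₀ (hw0 l l.2).ne'
  · rw [Matrix.one_apply_ne h]
    refine Finset.sum_eq_zero fun j _ => ?_
    split_ifs with h2 h3
    · exact absurd (Fin.ext (h2.symm.trans h3)) h
    all_goals simp

lemma exists_clamp {m k : ℕ} (hk : 1 ≤ k) :
    ∃ c : Fin m → Fin k, ∀ l < min m k, ∃ i, (c i : ℕ) = l :=
  ⟨fun i => ⟨min i (k - 1), by omega⟩, fun l hl => ⟨⟨l, by omega⟩, by simp; omega⟩⟩

lemma oneHot_apply_mem {D : Set ℝ} (hD : {0, 1} ⊆ D) {m k : ℕ} (c : Fin m → Fin k) (i : Fin m)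
    (j : Fin k) : oneHot c i j ∈ D := by
  rw [oneHot, Matrix.of_apply]
  split_ifs
  · exact hD (by simp)
  · exact hD (by simp)

lemma hasFrame_factorSet {D : Set ℝ} (hD : {0, 1} ⊆ D) {m k s d : ℕ} (hs : s ≤ k)
    (h0 : s = 0 → k = m) (hd : d ≤ min m k) : HasFrame (factorSet D m k s) d := by
  rcases Nat.eq_zero_or_pos s with rfl | hs0
  · obtain rfl := h0 rfl
    refine HasFrame.of_oneHot (c := id) ?_ fun l hl => ⟨⟨l, by omega⟩, rfl⟩
    rw [factorSet, if_pos rfl]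
    intro i j
    simp [oneHot, Fin.ext_iff, eq_comm]
  · obtain ⟨c, hc⟩ := exists_clamp (m := m) (hs0.trans_le hs)
    refine HasFrame.of_oneHot (c := c) ?_ fun l hl => hc l (by omega)
    rw [factorSet, if_neg (by omega)]
    exact ⟨oneHot_apply_mem hD c, fun i => by rw [hammingNorm_oneHot]; exact hs0⟩

lemma hasFrame_factorSetEq {D : Set ℝ} (hD : {0, 1} ⊆ D) {m k s d : ℕ} (hs : s ≤ k)
    (h0 : s = 0 → k = m) (hs1 : s ≤ 1) (hd : d ≤ min m k) :
    HasFrame (factorSetEq D m k s) d := by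
  rcases Nat.eq_zero_or_pos s with rfl | hs0
  · exact hasFrame_factorSet hD hs h0 hd
  · obtain ⟨c, hc⟩ := exists_clamp (m := m) (hs0.trans_le hs)
    refine HasFrame.of_oneHot (c := c) ?_ fun l hl => hc l (by omega)
    rw [factorSetEq, if_neg (by omega)]
    exact ⟨oneHot_apply_mem hD c, fun i => by rw [hammingNorm_oneHot]; omega⟩

/-! ### Row codes -/

/-- `2 ^ L` standard basis rows select the `2 ^ L` bit vectors of length `L`. -/
lemma rowCode_hammingNorm_eq_one {D : Set ℝ} (hD : {0, 1} ⊆ D) {k L : ℕ} (h : 2 ^ L ≤ k) :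
    RowCode {x : Fin k → ℝ | (∀ j, x j ∈ D) ∧ hammingNorm x = 1} (Fin L) := by
  classical
  obtain ⟨Φ⟩ : Nonempty ((Fin L → Bool) ↪ Fin k) :=
    Function.Embedding.nonempty_of_card_le (by simpa using h)
  refine ⟨fun e => oneHot (m := 1) (fun _ => Φ e) 0,
    Matrix.of fun i j => if ∃ f, Φ f = i ∧ f j = true then 1 else 0, 0,
    fun e => ⟨oneHot_apply_mem hD _ _, hammingNorm_oneHot _ _⟩, fun e j => ?_⟩
  rw [Finset.sum_eq_single (Φ e)]
  · simp [oneHot]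
  · rintro i - hi
    simp [oneHot, hi]
  · simp

/-- The columns are split into `s` blocks, each holding one column for every nonzero bit vector of
length `L`. A row with at most one entry per block then writes `s` words of `L` bits; the zero
word is written by leaving the block empty. -/
lemma rowCode_hammingNorm_le {D : Set ℝ} (hD : {0, 1} ⊆ D) {k s L : ℕ}
    (h : s * (2 ^ L - 1) ≤ k) :
    RowCode {x : Fin k → ℝ | (∀ j, x j ∈ D) ∧ hammingNorm x ≤ s} (Fin s × Fin L) := by
  classical
  obtain ⟨Φ⟩ : Nonempty (Fin s × {f : Fin L → Bool // f ≠ fun _ => false} ↪ Fin k) := by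
    refine Function.Embedding.nonempty_of_card_le ?_
    rw [Fintype.card_prod, Fintype.card_subtype_compl]
    simpa using h
  refine ⟨fun e i => if ∃ q, Φ q = i ∧ (fun j => e (q.1, j)) = q.2.1 then 1 else 0,
    Matrix.of fun i l => if ∃ q, Φ q = i ∧ q.1 = l.1 ∧ q.2.1 l.2 = true then 1 else 0, 0,
    fun e => ⟨fun j => ?_, ?_⟩, fun e l => ?_⟩
  · dsimp only
    split_ifs
    · exact hD (by simp)
    · exact hD (by simp)
  · have h1 : (Finset.univ.filter fun i => (if ∃ q, Φ q = i ∧ (fun j => e (q.1, j)) = q.2.1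
        then (1 : ℝ) else 0) ≠ 0) =
        (Finset.univ.filter fun q : Fin s × {f : Fin L → Bool // f ≠ fun _ => false} =>
          (fun j => e (q.1, j)) = q.2.1).image Φ := by
      ext i
      simp [and_comm]
    rw [hammingNorm, h1]
    refine Finset.card_image_le.trans ?_
    refine (Finset.card_le_card_of_injOn (t := (Finset.univ : Finset (Fin s))) Prod.fst
      (fun _ _ => Finset.mem_univ _) ?_).trans (by simp)
    rintro ⟨b, f⟩ hf ⟨b', f'⟩ hf' hbb
    simp only [Finset.coe_filter, Finset.mem_univ, true_and, Set.mem_ofPred_eq] at hf hf' hbb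
    subst hbb
    exact Prod.ext rfl (Subtype.ext (hf.symm.trans hf'))
  · obtain ⟨b, j⟩ := l
    simp only [Matrix.of_apply, Pi.zero_apply, zero_add]
    by_cases hb : e (b, j) = true
    · have hne : (fun j => e (b, j)) ≠ fun _ => false := fun h0 => by
        simp [congrFun h0 j] at hb
      rw [if_pos hb, Finset.sum_eq_single (Φ (b, ⟨_, hne⟩)), if_pos ⟨_, rfl, rfl⟩,
        if_pos ⟨_, rfl, rfl, hb⟩, mul_one]
      · rintro i - hi
        by_cases h1 : ∃ q, Φ q = i ∧ q.1 = b ∧ q.2.1 j = true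
        · obtain ⟨⟨b', f⟩, rfl, rfl, h2⟩ := h1
          rw [if_neg, zero_mul]
          rintro ⟨q, hq, hq2⟩
          obtain rfl := Φ.injective hq
          exact hi (congrArg Φ (Prod.ext rfl (Subtype.ext hq2.symm)))
        · rw [if_neg h1, mul_zero]
      · simp
    · rw [if_neg hb]
      refine Finset.sum_eq_zero fun i _ => ?_
      by_cases h1 : ∃ q, Φ q = i ∧ q.1 = b ∧ q.2.1 j = true
      · obtain ⟨⟨b', f⟩, rfl, rfl, h2⟩ := h1
        rw [if_neg, zero_mul]
        rintro ⟨q, hq, hq2⟩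
        obtain rfl := Φ.injective hq
        exact hb ((congrFun hq2 j).trans h2)
      · rw [if_neg h1, mul_zero]

/-- With a single column and no zero entry allowed, one bit per row is written by the choice
between `1` and another letter `d`. -/
lemma rowCode_single_column {D : Set ℝ} {d : ℝ} (h1 : 1 ∈ D) (hd : d ∈ D) (hd0 : d ≠ 0)
    (hd1 : d ≠ 1) :
    RowCode {x : Fin 1 → ℝ | (∀ j, x j ∈ D) ∧ hammingNorm x = 1} (Fin 1) := by
  have hs : d - 1 ≠ 0 := sub_ne_zero.2 hd1
  refine ⟨fun e _ => if e 0 then d else 1, fun _ _ => (d - 1)⁻¹, fun _ => (d - 1)⁻¹,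
    fun e => ⟨fun _ => ?_, ?_⟩, fun e j => ?_⟩
  · dsimp only
    split_ifs <;> assumption
  · cases h : e 0 <;> simp [hammingNorm, h, hd0]
  · obtain rfl : j = 0 := Subsingleton.elim _ _
    cases h : e 0 <;> simp [h]
    field_simp
    ring

/-! ### Rates and dimensions of cubes -/

lemma log_exp_one_mul_le {x : ℝ} (hx : 0 < x) {N : ℕ} (hN : 2 ≤ N) (hxN : x ≤ N) :
    Real.log (Real.exp 1 * x) ≤ 3 * Nat.log 2 N := by
  have h1 : (1 : ℝ) ≤ Nat.log 2 N := by
    exact_mod_cast Nat.log_pos (by norm_num) hN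
  have h2 : (N : ℝ) ≤ 2 ^ (Nat.log 2 N + 1) := by
    exact_mod_cast (Nat.lt_pow_succ_log_self (by norm_num) N).le
  have h3 : Real.log x ≤ (Nat.log 2 N + 1 : ℕ) * Real.log 2 := by
    rw [← Real.log_pow]
    exact Real.log_le_log hx (hxN.trans h2)
  rw [Real.log_mul (Real.exp_pos 1).ne' hx.ne', Real.log_exp]
  push_cast at h3
  nlinarith [Real.log_two_lt_d9]

lemma rateX_le_card {n m kn km sn d : ℕ}
    (h : min ((min m km : ℕ) : ℝ) (sn * Real.log (Real.exp 1 * kn / sn)) ≤ 3 * d) :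
    rateX n m kn km sn ≤ 3 * Fintype.card (Fin n × Fin d) := by
  rw [rateX, ← mul_min_of_nonneg _ _ (Nat.cast_nonneg n), Fintype.card_prod, Fintype.card_fin,
    Fintype.card_fin, Nat.cast_mul]
  nlinarith [mul_le_mul_of_nonneg_left h (Nat.cast_nonneg n : (0 : ℝ) ≤ n)]

/-- When `n ≤ kn` the rate of the first factor is already dominated by that of the middle one. -/
lemma rateX_le_card_of_le {n m kn km sn : ℕ} (h : n ≤ kn) :
    rateX n m kn km sn ≤ 3 * Fintype.card (Fin (min n kn) × Fin (min m km)) := by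
  rw [min_eq_left h]
  refine rateX_le_card ((min_le_left _ _).trans ?_)
  have : (0 : ℝ) ≤ (min m km : ℕ) := Nat.cast_nonneg _
  linarith

lemma min_le_three_mul_min {r N : ℕ} {x : ℝ} (h : x ≤ 3 * N) :
    min (r : ℝ) x ≤ 3 * (min r N : ℕ) := by
  have hr : (0 : ℝ) ≤ r := Nat.cast_nonneg r
  rcases le_total r N with h' | h'
  · rw [min_eq_left h']; exact (min_le_left _ _).trans (by linarith)
  · rw [min_eq_right h']; exact (min_le_right _ _).trans h

lemma exists_hasCube_factorSet {D : Set ℝ} (hD : {0, 1} ⊆ D) {n m kn km sn : ℕ} (hs : sn ≤ kn)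
    (h0 : sn = 0 → kn = n) {Z : Set (Matrix (Fin m) (Fin km) ℝ)}
    (hZ : ∀ d ≤ min m km, HasFrame Z d) :
    ∃ (ι : Type) (_ : Fintype ι), HasCube (productClass (factorSet D n kn sn) Z) ι ∧
      rateX n m kn km sn ≤ 3 * Fintype.card ι := by
  rcases le_or_gt n kn with hn | hn
  · exact ⟨_, inferInstance, (hasFrame_factorSet hD hs h0 le_rfl).hasCube (hZ _ le_rfl),
      rateX_le_card_of_le hn⟩
  have hs0 : 0 < sn := Nat.pos_of_ne_zero fun h => by have := h0 h; omega
  set N := kn / sn + 1 with hN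
  have hN2 : 2 ≤ N := by have := Nat.div_pos hs hs0; omega
  set L := Nat.log 2 N with hL
  have hpow : sn * (2 ^ L - 1) ≤ kn := by
    have h1 : 2 ^ L ≤ N := Nat.pow_log_le_self 2 (by omega)
    exact (Nat.mul_le_mul_left sn (by omega : 2 ^ L - 1 ≤ kn / sn)).trans (Nat.mul_div_le kn sn)
  obtain ⟨g⟩ : Nonempty (Fin (min (min m km) (sn * L)) ↪ Fin sn × Fin L) :=
    Function.Embedding.nonempty_of_card_le (by simp)
  refine ⟨_, inferInstance, ((rowCode_hammingNorm_le hD hpow).comp g).hasCube (fun A hA => ?_)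
    (hZ _ (min_le_left _ _)), rateX_le_card (min_le_three_mul_min ?_)⟩
  · rw [factorSet, if_neg hs0.ne']
    exact ⟨fun i => (hA i).1, fun i => (hA i).2⟩
  · have hsr : (0 : ℝ) < sn := by exact_mod_cast hs0
    have hkr : (0 : ℝ) < kn := by exact_mod_cast hs0.trans_le hs
    have h1 : (kn : ℝ) / sn ≤ N := by
      rw [div_le_iff₀ hsr]
      exact_mod_cast (Nat.lt_mul_of_div_lt (Nat.lt_succ_self _) hs0).le
    have h2 := log_exp_one_mul_le (div_pos hkr hsr) hN2 h1
    rw [mul_div_assoc]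
    push_cast
    nlinarith [mul_le_mul_of_nonneg_left h2 hsr.le]

lemma exists_hasCube_factorSetEq {D : Set ℝ} (hD : {0, 1} ⊆ D) {n m kn km sn : ℕ} (hs : sn ≤ kn)
    (h0 : sn = 0 → kn = n) (hs1 : sn ≤ 1) (hdeg : ¬ (sn = 1 ∧ kn = 1 ∧ D = {0, 1}))
    {Z : Set (Matrix (Fin m) (Fin km) ℝ)} (hZ : ∀ d ≤ min m km, HasFrame Z d) :
    ∃ (ι : Type) (_ : Fintype ι), HasCube (productClass (factorSetEq D n kn sn) Z) ι ∧
      rateX n m kn km sn ≤ 3 * Fintype.card ι := by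
  rcases le_or_gt n kn with hn | hn
  · exact ⟨_, inferInstance, (hasFrame_factorSetEq hD hs h0 hs1 le_rfl).hasCube (hZ _ le_rfl),
      rateX_le_card_of_le hn⟩
  obtain rfl : sn = 1 := by
    rcases Nat.eq_zero_or_pos sn with h | h
    · have := h0 h; omega
    · omega
  -- It suffices to store `N` bits per row, with `N` of the order of `log (e kn)`.
  obtain ⟨N, hN, hlog⟩ : ∃ N, RowCode {x : Fin kn → ℝ | (∀ j, x j ∈ D) ∧ hammingNorm x = 1}
      (Fin N) ∧ Real.log (Real.exp 1 * kn) ≤ 3 * N := by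
    rcases hs.eq_or_lt with rfl | hk
    · have hne : D ≠ {0, 1} := fun h => hdeg ⟨rfl, rfl, h⟩
      obtain ⟨d, hd, hd'⟩ : ∃ d ∈ D, d ∉ ({0, 1} : Set ℝ) := by
        by_contra! h
        exact hne (Set.Subset.antisymm h hD)
      simp only [Set.mem_insert_iff, Set.mem_singleton_iff, not_or] at hd'
      exact ⟨1, rowCode_single_column (hD (by simp)) hd hd'.1 hd'.2, by simp⟩
    · exact ⟨Nat.log 2 kn, rowCode_hammingNorm_eq_one hD (Nat.pow_log_le_self 2 (by omega)),
        log_exp_one_mul_le (by exact_mod_cast (by omega : 0 < kn)) hk le_rfl⟩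
  refine ⟨_, inferInstance, (hN.comp (Fin.castLEEmb (min_le_right (min m km) N))).hasCube
    (fun A hA => ?_) (hZ _ (min_le_left _ _)), rateX_le_card (min_le_three_mul_min ?_)⟩
  · rw [factorSetEq, if_neg one_ne_zero]
    exact ⟨fun i => (hA i).1, fun i => (hA i).2⟩
  · simpa using hlog

/-- Cubes matching the three summands of the rate: the largest has dimension at least a
ninth of the sum. -/
lemma minimax_lower_bounds_of_cubes {n m kn km sn sm : ℕ} {Θ : Set (Matrix (Fin n) (Fin m) ℝ)}
    {p : unitInterval} (hp : 0 < p) {σ : ℝ} (hσ : 0 < σ)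
    (hX : ∃ (ι : Type) (_ : Fintype ι), HasCube Θ ι ∧ rateX n m kn km sn ≤ 3 * Fintype.card ι)
    (hB : HasCube Θ (Fin (min n kn) × Fin (min m km)))
    (hZ : ∃ (ι : Type) (_ : Fintype ι), HasCube Θ ι ∧ rateZ n m kn km sm ≤ 3 * Fintype.card ι) :
    1 / 10 ≤ minimaxDevProb p σ Θ (1 / 36000 * completionRate n m kn km sn sm p σ) ∧
      ENNReal.ofReal (1 / 36000 * completionRate n m kn km sn sm p σ) ≤ minimaxSqRisk p σ Θ := by
  have hp' : (0 : ℝ) < p := hp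
  have hσp : 0 < σ ^ 2 / p := by positivity
  set T := completionRate n m kn km sn sm p σ with hT
  have key : ∃ (ι : Type) (_ : Fintype ι), HasCube Θ ι ∧
      rateX n m kn km sn + rateB n m kn km + rateZ n m kn km sm ≤ 9 * Fintype.card ι := by
    obtain ⟨ι, _, h1, h2⟩ := hX
    obtain ⟨κ, _, h3, h4⟩ := hZ
    have h5 : rateB n m kn km = Fintype.card (Fin (min n kn) × Fin (min m km)) := by
      simp [rateB]
    have h6 : (0 : ℝ) ≤ Fintype.card (Fin (min n kn) × Fin (min m km)) := Nat.cast_nonneg _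
    by_cases h : (Fintype.card ι : ℝ) ≤ Fintype.card κ
    · by_cases h' : (Fintype.card (Fin (min n kn) × Fin (min m km)) : ℝ) ≤ Fintype.card κ
      · exact ⟨κ, _, h3, by linarith⟩
      · exact ⟨_, inferInstance, hB, by linarith⟩
    · by_cases h' : (Fintype.card (Fin (min n kn) × Fin (min m km)) : ℝ) ≤ Fintype.card ι
      · exact ⟨ι, _, h1, by linarith⟩
      · exact ⟨_, inferInstance, hB, by linarith⟩
  obtain ⟨ι, _, hι, hle⟩ := key
  have hT9 : T ≤ σ ^ 2 / p * (9 * Fintype.card ι) := mul_le_mul_of_nonneg_left hle hσp.le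
  have hdev : 1 / 10 ≤ minimaxDevProb p σ Θ (T / 3600) :=
    le_minimaxDevProb_of_hasCube hι hp hσ (by linarith)
  refine ⟨?_, ?_⟩
  · rcases le_total 0 T with h | h
    · exact hdev.trans (minimaxDevProb_anti (by linarith))
    · exact le_minimaxDevProb_of_hasCube hι hp hσ
        (le_trans (by linarith) (by positivity : (0 : ℝ) ≤ σ ^ 2 / p * Fintype.card ι / 400))
  · have := ofReal_le_minimaxSqRisk hdev
    rwa [show 1 / 36000 * T = T / 3600 / 10 by ring]

theorem theorem2 :
    ∃ C : ℝ, 0 < C ∧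
      ∀ (n m kn km sn sm : ℕ), sn ≤ kn → sm ≤ km → (sn = 0 → kn = n) → (sm = 0 → km = m) →
      ∀ (p : unitInterval), 0 < p →
      ∀ (σ : ℝ), 0 < σ →
      ∀ (Dn Dm : Set ℝ), {0, 1} ⊆ Dn → {0, 1} ⊆ Dm →
        ((1 / 10 : ℝ≥0∞) ≤ minimaxDevProb p σ (thetaClass Dn Dm n m kn km sn sm)
            (C * completionRate n m kn km sn sm p σ) ∧
          ENNReal.ofReal (C * completionRate n m kn km sn sm p σ) ≤
            minimaxSqRisk p σ (thetaClass Dn Dm n m kn km sn sm)) ∧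
        (sn ∈ ({0, 1} : Set ℕ) → sm ∈ ({0, 1} : Set ℕ) →
          ¬ (sn = 1 ∧ kn = 1 ∧ Dn = {0, 1}) → ¬ (sm = 1 ∧ km = 1 ∧ Dm = {0, 1}) →
          ((1 / 10 : ℝ≥0∞) ≤ minimaxDevProb p σ (thetaClassEq Dn Dm n m kn km sn sm)
              (C * completionRate n m kn km sn sm p σ) ∧
            ENNReal.ofReal (C * completionRate n m kn km sn sm p σ) ≤
              minimaxSqRisk p σ (thetaClassEq Dn Dm n m kn km sn sm))) := by
  refine ⟨1 / 36000, by norm_num, fun n m kn km sn sm hsn hsm hn0 hm0 p hp σ hσ Dn Dm hDn hDm =>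
    ⟨?_, fun h1 h2 hdn hdm => ?_⟩⟩
  · have hFn := fun d (hd : d ≤ min n kn) => hasFrame_factorSet hDn hsn hn0 hd
    have hFm := fun d (hd : d ≤ min m km) => hasFrame_factorSet hDm hsm hm0 hd
    refine minimax_lower_bounds_of_cubes hp hσ (exists_hasCube_factorSet hDn hsn hn0 hFm)
      ((hFn _ le_rfl).hasCube (hFm _ le_rfl)) ?_
    obtain ⟨ι, _, h3, h4⟩ := exists_hasCube_factorSet hDm hsm hm0 hFn
    exact ⟨ι, _, h3.transpose, h4⟩
  · have hn1 : sn ≤ 1 := by rcases h1 with h | h <;> simp_all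
    have hm1 : sm ≤ 1 := by rcases h2 with h | h <;> simp_all
    have hFn := fun d (hd : d ≤ min n kn) => hasFrame_factorSetEq hDn hsn hn0 hn1 hd
    have hFm := fun d (hd : d ≤ min m km) => hasFrame_factorSetEq hDm hsm hm0 hm1 hd
    refine minimax_lower_bounds_of_cubes hp hσ
      (exists_hasCube_factorSetEq hDn hsn hn0 hn1 hdn hFm)
      ((hFn _ le_rfl).hasCube (hFm _ le_rfl)) ?_
    obtain ⟨ι, _, h3, h4⟩ := exists_hasCube_factorSetEq hDm hsm hm0 hm1 hdm hFn
    exact ⟨ι, _, h3.transpose, h4⟩
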